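/- Let $G=(V,E)$ be a finite simple $3$-connected graph (deleting any one or two vertices leaves a connected, nonempty graph), let $G$ be embedded in the plane, i.e. given as a planar map with at least one edge, and let $st$ be a distinguished directed edge (the root). Write $G^*$ for the dual map, whose vertices are the faces of $G$; for each edge $e$ let $e^*$ be its dual edge, and let $s^*$ (resp. $t^*$) be the face to the right (resp. left) of $st$. View $G$ with the edge $st$ cut as an electrical network of unit resistors, and let $P:V\to\mathbb{R}$ be the potential with $P(s)=1$, $P(t)=0$, so that Kirchhoff's law $\sum_{w\sim v}(P(v)-P(w))=0$ holds at all $v\ne s,t$. Let $\lambda=\sum_{w\sim s,\,w\neq t}(1-P(w))$ be the total current from $s$ to $t$. Similarly let $P^*$ be the potential on the faces, in the network $G^*$ with $s^*t^*$ cut, with $P^*(s^*)=\lambda$ and $P^*(t^*)=0$. For each edge $e=uv\neq st$, with $e^*$ joining the faces $f,g$, let $s_e\subset\mathbb{R}^2$ be the closed (possibly degenerate) square with side length $|P(u)-P(v)|$ and top left corner $(\min(P^*(f),P^*(g)),\max(P(u),P(v)))$; these squares form the squaring of the rectangle $[0,\lambda]\times[0,1]$ associated with $(G,st)$. For a vertex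 $v$, the primal line $\ell(v)$ is the horizontal segment at height $P(v)$ whose left and right ends have the minimal and maximal $x$-coordinate occurring in the squares $s_e$, $e\ne st$ incident to $v$. For a face $f$, the facial line $\ell(f)$ is the vertical segment with abscissa $P^*(f)$ whose lower and upper ends have the minimal and maximal $y$-coordinate occurring in the squares $s_e$, $e\neq st$ incident to $f$. Then every primal line $\ell(v)$, $v\in V$, and every facial line $\ell(f)$, $f$ a face of $G$, is non-degenerate, i.e. is not a single point. -/

import Mathlib

noncomputable section

/-- A graph is 3-connected if deleting any two vertices leaves it connected (in particular
nonempty). The vertices `u` and `v` may coincide, so deleting a single vertex is covered too: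
the graphs singled out are the triangle and the 3-connected graphs on at least four vertices. -/
def IsThreeConnected {V : Type*} (G : SimpleGraph V) : Prop :=
  ∀ u v : V, (G.induce ({u, v}ᶜ : Set V)).Connected

/-- A rotation system on a simple graph: for each vertex `v`, a cyclic order (the
counterclockwise order in the plane) of the darts (directed edges) with tail `v`. -/
structure RotationSystem {V : Type*} (G : SimpleGraph V) where
  /-- The next dart counterclockwise around the tail. -/
  rot : Equiv.Perm G.Dart
  /-- The cycles of `rot` are exactly the sets of darts having a common tail. -/
  sameCycle_rot : ∀ d d' : G.Dart, rot.SameCycle d d' ↔ d.fst = d'.fst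

namespace RotationSystem

variable {V : Type*} {G : SimpleGraph V} (R : RotationSystem G)

/-- Reversal of darts, as a permutation. -/
def flip : Equiv.Perm G.Dart where
  toFun := SimpleGraph.Dart.symm
  invFun := SimpleGraph.Dart.symm
  left_inv := fun d => d.symm_symm
  right_inv := fun d => d.symm_symm

/-- The dart that follows `d` when one walks along the boundary of the face to the left of `d`:
from the head of `d` one leaves along the dart that comes just before the reversal of `d` in the
counterclockwise order around that vertex. -/
def faceNext : Equiv.Perm G.Dart := (flip (G := G)).trans R.rot⁻¹

/-- The faces are the cycles of the face permutation `faceNext`. -/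
def Face : Type _ := Quotient (Equiv.Perm.SameCycle.setoid R.faceNext)

/-- The face to the left of a dart. -/
def leftFace (d : G.Dart) : R.Face := Quotient.mk _ d

/-- The face to the right of a dart. -/
def rightFace (d : G.Dart) : R.Face := R.leftFace d.symm

theorem face_rot (d : G.Dart) : R.rightFace (R.rot d) = R.leftFace d := by
  refine Quotient.sound (?_ : R.faceNext.SameCycle (R.rot d).symm d)
  refine ⟨1, ?_⟩
  simp [RotationSystem.faceNext, RotationSystem.flip]

end RotationSystem

/-- A finite edge-rooted planar map: a connected simple graph `G` with at least one edge, together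
with a rotation system satisfying Euler's formula (that is, an embedding in the sphere, up to
orientation-preserving homeomorphism) and a distinguished directed edge, the root. -/
structure EdgeRootedPlanarMap {V : Type*} (G : SimpleGraph V) extends RotationSystem G where
  connected : G.Connected
  euler : Nat.card V + Nat.card toRotationSystem.Face = Nat.card G.edgeSet + 2
  /-- The root edge `st`, directed from `s` to `t`. -/
  root : G.Dart

/-- `P` is a potential for the electrical network with arcs `arcs` (the arc `d` leading from
`src d` to `tgt d`, each edge being represented by two opposite arcs of unit resistance), when a
potential `a` is applied at `s` and `t` is grounded: by Ohm's and Kirchhoff's laws, at each other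
node the total outgoing current vanishes. -/
def IsPotential {A X : Type*} [DecidableEq X] (arcs : Finset A) (src tgt : A → X) (s t : X)
    (a : ℝ) (P : X → ℝ) : Prop :=
  P s = a ∧ P t = 0 ∧
    ∀ x, x ≠ s → x ≠ t → ∑ d ∈ arcs with src d = x, (P x - P (tgt d)) = 0

open Classical in
/-- The potential of an electrical network, as in `IsPotential`; it exists and is unique
as soon as `s ≠ t` and each node is linked to `s` or `t`, see `isPotential_existsUnique`. -/
def potential {A X : Type*} [DecidableEq X] (arcs : Finset A) (src tgt : A → X) (s t : X)
    (a : ℝ) : X → ℝ :=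
  if h : ∃ P, IsPotential arcs src tgt s t a P then h.choose else 0

section Existence

variable {A X : Type*} [DecidableEq X] {arcs : Finset A} {src tgt : A → X} {s t : X}

/-- Maximum principle: a potential with boundary value `0` is nonpositive. -/
theorem IsPotential.nonpos [Finite X]
    (hreach : ∀ x, ∃ z, (z = s ∨ z = t) ∧
      Relation.ReflTransGen (fun x y => ∃ d ∈ arcs, src d = x ∧ tgt d = y) x z)
    {P : X → ℝ} (hP : IsPotential arcs src tgt s t 0 P) (x : X) : P x ≤ 0 := by
  obtain ⟨hs, ht, hharm⟩ := hP
  have : Nonempty X := ⟨s⟩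
  obtain ⟨m, hm⟩ := Finite.exists_max P
  obtain ⟨z, hz, hpath⟩ := hreach m
  have hkey : P z = P m ∨ P m = 0 := by
    clear hz
    induction hpath with
    | refl => exact Or.inl rfl
    | @tail b c _ hbc ih =>
      rcases ih with hb | h0
      · by_cases hbs : b = s
        · right; rw [← hb, hbs, hs]
        by_cases hbt : b = t
        · right; rw [← hb, hbt, ht]
        obtain ⟨d, hd, hsrc, htgt⟩ := hbc
        have hnn : ∀ e ∈ arcs.filter (fun e => src e = b), 0 ≤ P b - P (tgt e) := by
          intro e _
          rw [hb]
          linarith [hm (tgt e)]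
        have := (Finset.sum_eq_zero_iff_of_nonneg hnn).1 (hharm b hbs hbt) d
          (Finset.mem_filter.2 ⟨hd, hsrc⟩)
        rw [htgt] at this
        left; linarith
      · exact Or.inr h0
  have hz0 : P z = 0 := by rcases hz with rfl | rfl <;> assumption
  have := hm x
  rcases hkey with h | h <;> linarith

/-- Existence and uniqueness of the potential. -/
theorem isPotential_existsUnique [Finite X] (hst : s ≠ t)
    (hreach : ∀ x, ∃ z, (z = s ∨ z = t) ∧
      Relation.ReflTransGen (fun x y => ∃ d ∈ arcs, src d = x ∧ tgt d = y) x z)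
    (a : ℝ) : ∃! P, IsPotential arcs src tgt s t a P := by
  classical
  let L : (X → ℝ) →ₗ[ℝ] (X → ℝ) :=
    { toFun := fun P x => if x = s ∨ x = t then P x
        else ∑ d ∈ arcs with src d = x, (P x - P (tgt d))
      map_add' := by
        intro P Q
        funext x
        simp only [Pi.add_apply]
        split_ifs
        · rfl
        · rw [← Finset.sum_add_distrib]
          exact Finset.sum_congr rfl fun d _ => by ring
      map_smul' := by
        intro c P
        funext x
        simp only [Pi.smul_apply, smul_eq_mul, RingHom.id_apply]
        split_ifs
        · rfl
        · rw [Finset.mul_sum]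
          exact Finset.sum_congr rfl fun d _ => by ring }
  have hiff : ∀ (b : ℝ) (P : X → ℝ),
      IsPotential arcs src tgt s t b P ↔ L P = fun x => if x = s then b else 0 := by
    intro b P
    constructor
    · rintro ⟨h1, h2, h3⟩
      funext x
      change (if x = s ∨ x = t then P x else _) = _
      by_cases hs : x = s
      · simp [hs, h1]
      by_cases ht : x = t
      · rw [if_pos (Or.inr ht), if_neg hs, ht, h2]
      · rw [if_neg (by tauto), if_neg hs, h3 x hs ht]
    · intro h
      refine ⟨?_, ?_, ?_⟩
      · have := congrFun h s
        change (if s = s ∨ s = t then P s else _) = _ at this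
        simpa using this
      · have := congrFun h t
        change (if t = s ∨ t = t then P t else _) = _ at this
        rw [if_pos (Or.inr rfl), if_neg hst.symm] at this
        exact this
      · intro x hs ht
        have := congrFun h x
        change (if x = s ∨ x = t then P x else _) = _ at this
        rw [if_neg (by tauto), if_neg hs] at this
        exact this
  have hinj : Function.Injective L := by
    rw [injective_iff_map_eq_zero]
    intro P hP
    have h1 : IsPotential arcs src tgt s t 0 P := (hiff 0 P).2 (by rw [hP]; funext x; simp)
    have h2 : IsPotential arcs src tgt s t 0 (-P) :=
      (hiff 0 (-P)).2 (by rw [map_neg, hP]; funext x; simp)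
    funext x
    have h3 := h1.nonpos hreach x
    have h4 := h2.nonpos hreach x
    simp only [Pi.neg_apply, Pi.zero_apply] at h4 ⊢
    linarith
  have hsurj : Function.Surjective L := LinearMap.injective_iff_surjective.1 hinj
  obtain ⟨P, hP⟩ := hsurj (fun x => if x = s then a else 0)
  exact ⟨P, (hiff a P).2 hP, fun Q hQ => hinj (((hiff a Q).1 hQ).trans hP.symm)⟩

theorem isPotential_potential [Finite X] (hst : s ≠ t)
    (hreach : ∀ x, ∃ z, (z = s ∨ z = t) ∧
      Relation.ReflTransGen (fun x y => ∃ d ∈ arcs, src d = x ∧ tgt d = y) x z)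
    (a : ℝ) : IsPotential arcs src tgt s t a (potential arcs src tgt s t a) := by
  have h := (isPotential_existsUnique hst hreach a).exists
  rw [potential, dif_pos h]
  exact h.choose_spec

end Existence

namespace EdgeRootedPlanarMap

variable {V : Type*} [Fintype V] [DecidableEq V] {G : SimpleGraph V} [DecidableRel G.Adj]
  (M : EdgeRootedPlanarMap G)

/-- The darts of the network obtained by cutting the root edge. -/
def arcs : Finset G.Dart := {d | d ≠ M.root ∧ d ≠ M.root.symm}

/-- The potential `P(v)` at the vertices: 1 volt at `s`, ground at `t`, root edge cut. -/
def vertexPotential : V → ℝ :=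
  potential M.arcs (fun d => d.fst) (fun d => d.snd) M.root.fst M.root.snd 1

/-- The total current `λ` flowing from `s` to `t`. -/
def totalCurrent : ℝ :=
  ∑ d ∈ M.arcs with d.fst = M.root.fst, (M.vertexPotential M.root.fst - M.vertexPotential d.snd)

open Classical in
/-- The potential at the faces, that is, at the vertices of the planar dual, where the edge dual
to `d` is directed from the right of `d` to the left of `d`. The potential is `λ` at the face `s*`
to the right of the root, the face `t*` to the left of the root is grounded, and the edge dual to
the root is cut. -/
def facePotential : M.Face → ℝ :=
  potential M.arcs M.rightFace M.leftFace (M.rightFace M.root) (M.leftFace M.root) M.totalCurrent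

/-- The potential at the vertices is a genuine one. -/
theorem isPotential_vertexPotential :
    IsPotential M.arcs (fun d => d.fst) (fun d => d.snd) M.root.fst M.root.snd 1
      M.vertexPotential := by
  refine isPotential_potential M.root.adj.ne (fun x => ?_) 1
  have h := (SimpleGraph.reachable_iff_reflTransGen _ _).1
    (M.connected.preconnected x M.root.fst)
  induction h using Relation.ReflTransGen.head_induction_on with
  | refl => exact ⟨_, Or.inl rfl, Relation.ReflTransGen.refl⟩
  | @head b c hbc _ ih =>
    by_cases hbs : b = M.root.fst
    · exact ⟨b, Or.inl hbs, Relation.ReflTransGen.refl⟩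
    by_cases hbt : b = M.root.snd
    · exact ⟨b, Or.inr hbt, Relation.ReflTransGen.refl⟩
    obtain ⟨z, hz, hp⟩ := ih
    refine ⟨z, hz, Relation.ReflTransGen.head ⟨⟨(b, c), hbc⟩, ?_, rfl, rfl⟩ hp⟩
    simp only [arcs, Finset.mem_filter, Finset.mem_univ, true_and]
    constructor
    · intro h; exact hbs (congrArg (fun d : G.Dart => d.fst) h)
    · intro h; exact hbt (congrArg (fun d : G.Dart => d.fst) h)

open Classical in
/-- The potential at the faces is a genuine one as soon as the two sides of the root lie in
different faces, that is, as soon as the root is not a cut-edge. -/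
theorem isPotential_facePotential (hne : M.rightFace M.root ≠ M.leftFace M.root) :
    IsPotential M.arcs M.rightFace M.leftFace (M.rightFace M.root) (M.leftFace M.root)
      M.totalCurrent M.facePotential := by
  have : Finite M.Face := inferInstanceAs (Finite (Quotient _))
  refine isPotential_potential hne (fun x => ?_) _
  let E : M.Face → M.Face → Prop := fun x y => ∃ d : G.Dart, M.rightFace d = x ∧ M.leftFace d = y
  -- all faces are linked in the dual graph
  have hflip : ∀ d : G.Dart, Relation.ReflTransGen E (M.leftFace d) (M.leftFace d.symm) :=
    fun d => .single ⟨d.symm, by simp [RotationSystem.rightFace], rfl⟩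
  have hrot : ∀ d : G.Dart, Relation.ReflTransGen E (M.leftFace d) (M.leftFace (M.rot d)) :=
    fun d => .single ⟨M.rot d, M.face_rot d, rfl⟩
  have hcyc : ∀ d d' : G.Dart, d.fst = d'.fst →
      Relation.ReflTransGen E (M.leftFace d) (M.leftFace d') := by
    intro d d' h
    obtain ⟨n, rfl⟩ := ((M.sameCycle_rot d d').2 h).exists_nat_pow_eq
    clear h
    induction n with
    | zero => exact .refl
    | succ n ih =>
      rw [pow_succ', Equiv.Perm.mul_apply]
      exact ih.trans (hrot _)
  have hall : ∀ d : G.Dart, Relation.ReflTransGen E (M.leftFace d) (M.leftFace M.root) := by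
    have hv : ∀ v : V, ∀ d : G.Dart, d.fst = v →
        Relation.ReflTransGen E (M.leftFace d) (M.leftFace M.root) := by
      intro v
      have h := (SimpleGraph.reachable_iff_reflTransGen _ _).1
        (M.connected.preconnected v M.root.fst)
      induction h using Relation.ReflTransGen.head_induction_on with
      | refl => exact fun d hd => hcyc d M.root hd
      | @head b c hbc _ ih =>
        intro d hd
        let e : G.Dart := ⟨(b, c), hbc⟩
        exact ((hcyc d e hd).trans (hflip e)).trans (ih e.symm rfl)
    exact fun d => hv d.fst d rfl
  obtain ⟨d, rfl⟩ := Quotient.exists_rep x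
  have h := hall d
  change ∃ z, _ ∧ Relation.ReflTransGen _ (M.leftFace d) z
  generalize M.leftFace d = x at h ⊢
  induction h using Relation.ReflTransGen.head_induction_on with
  | refl => exact ⟨_, Or.inr rfl, Relation.ReflTransGen.refl⟩
  | @head b c hbc _ ih =>
    by_cases hbs : b = M.rightFace M.root
    · exact ⟨b, Or.inl hbs, Relation.ReflTransGen.refl⟩
    by_cases hbt : b = M.leftFace M.root
    · exact ⟨b, Or.inr hbt, Relation.ReflTransGen.refl⟩
    obtain ⟨z, hz, hp⟩ := ih
    obtain ⟨e, he, he'⟩ := hbc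
    refine ⟨z, hz, Relation.ReflTransGen.head ⟨e, ?_, he, he'⟩ hp⟩
    simp only [arcs, Finset.mem_filter, Finset.mem_univ, true_and]
    constructor
    · rintro rfl; exact hbs he.symm
    · rintro rfl; exact hbt (by rw [← he]; simp [RotationSystem.rightFace])

/-- The side length of the square of the edge underlying `d`: the current through that edge. -/
def side (d : G.Dart) : ℝ := |M.vertexPotential d.fst - M.vertexPotential d.snd|

/-- The ordinate of the top side of the square of the edge underlying `d`. -/
def top (d : G.Dart) : ℝ := max (M.vertexPotential d.fst) (M.vertexPotential d.snd)

/-- The abscissa of the left side of the square of the edge underlying `d`. -/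
def left (d : G.Dart) : ℝ :=
  min (M.facePotential (M.rightFace d)) (M.facePotential (M.leftFace d))

/-- The (closed, possibly degenerate) square of the edge underlying `d`. -/
def square (d : G.Dart) : Set (ℝ × ℝ) :=
  Set.Icc (M.left d) (M.left d + M.side d) ×ˢ Set.Icc (M.top d - M.side d) (M.top d)

/-- The union of the squares of the non-root edges incident to the vertex `v`. -/
def vertexSquares (v : V) : Set (ℝ × ℝ) := ⋃ d ∈ {d ∈ M.arcs | d.fst = v}, M.square d

open Classical in
/-- The union of the squares of the non-root edges incident to the face `f`. -/
def faceSquares (f : M.Face) : Set (ℝ × ℝ) := ⋃ d ∈ {d ∈ M.arcs | M.leftFace d = f}, M.square d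

/-- The primal line of the vertex `v`: the horizontal segment at height `P(v)` spanning the
abscissas of the points of the squares of the edges incident to `v`. -/
def primalLine (v : V) : Set (ℝ × ℝ) :=
  Set.Icc (sInf (Prod.fst '' M.vertexSquares v)) (sSup (Prod.fst '' M.vertexSquares v)) ×ˢ
    {M.vertexPotential v}

/-- The facial line of the face `f`: the vertical segment whose abscissa is the potential of `f`
and which spans the ordinates of the points of the squares of the edges incident to `f`. -/
def facialLine (f : M.Face) : Set (ℝ × ℝ) :=
  {M.facePotential f} ×ˢ
    Set.Icc (sInf (Prod.snd '' M.faceSquares f)) (sSup (Prod.snd '' M.faceSquares f))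

end EdgeRootedPlanarMap

end

/-!
All squares have side `|P(u) - P(v)|`, so a primal line is non-degenerate as soon as `P` is not
constant along the non-root edges at the vertex, and a facial line as soon as `P` is not constant
along the non-root edges of the face. The potential on the faces plays no role.

`P` is harmonic except at `s` and `t`. By the maximum principle and 3-connectedness, `0 < P < 1`
away from `s` and `t`, which settles the vertices `s` and `t` and the faces at the root
(`IsHarmonicOff.lt_source`, `IsHarmonicOff.sink_lt`), and for `0 < c < 1` the sets `{P > c}` and
`{P < c}` are connected (`IsHarmonicOff.preconnected_superlevel`).

Suppose that all neighbours of a vertex are at its height `c`, and let `Z` be the connected cluster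
of such vertices around it. By 3-connectedness three vertices outside `Z` are adjacent to `Z`. They
have height `c`, and, being harmonic but not flat, a neighbour above and a neighbour below. So these
three vertices, `Z`, `{P > c}` and `{P < c}` form a `K₃,₃` minor
(`IsHarmonicOff.exists_adj_ne`). Once vertices are settled, a currentless face gives the same
contradiction, with a point inside the face in place of `Z`
(`EdgeRootedPlanarMap.exists_arc_leftFace_eq`).

That `K₃,₃` is not planar is proved directly for rotation systems. Euler's formula says that every
mod 2 cycle bounds, i.e. is the interface of a two-colouring of the faces
(`RotationSystem.exists_face_coloring`). For a simple cycle the colour on its left is constant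
along the cycle (`RotationSystem.color_left_eq_of_isChain`). Each of the three vertices sees
`{P > c}`, `Z` and `{P < c}` in one of two cyclic orders, so two of them see the same order; a cycle
through these two, `{P > c}` and `{P < c}` then separates `Z` at the first from `Z` at the second
(`RotationSystem.exists_coloring_ne_of_three`).
-/

/-! ### Mod 2 homology of a spherical rotation system -/

/-- A quantity that does not change along the edges of a connected graph is constant. -/
theorem SimpleGraph.Connected.eq_of_forall_adj {V α : Type*} {G : SimpleGraph V}
    (hG : G.Connected) {f : V → α} (hf : ∀ u v, G.Adj u v → f u = f v) (u v : V) : f u = f v := by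
  have h := (SimpleGraph.reachable_iff_reflTransGen _ _).1 (hG.preconnected u v)
  induction h with
  | refl => rfl
  | tail _ hbc ih => exact ih.trans (hf _ _ hbc)

namespace RotationSystem

variable {V : Type*} {G : SimpleGraph V} (R : RotationSystem G)

theorem rot_fst (d : G.Dart) : (R.rot d).fst = d.fst :=
  ((R.sameCycle_rot d (R.rot d)).1 ⟨1, by simp⟩).symm

theorem rot_pow_fst (d : G.Dart) (n : ℕ) : ((R.rot ^ n) d).fst = d.fst :=
  ((R.sameCycle_rot d ((R.rot ^ n) d)).1 ⟨n, by simp⟩).symm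

theorem exists_rot_pow_eq [Finite V] {d d' : G.Dart} (h : d.fst = d'.fst) :
    ∃ n : ℕ, (R.rot ^ n) d = d' := by
  have : Finite G.Dart := Finite.of_injective _ SimpleGraph.Dart.toProd_injective
  exact ((R.sameCycle_rot d d').2 h).exists_nat_pow_eq

theorem rightFace_symm (d : G.Dart) : R.rightFace d.symm = R.leftFace d := by
  simp [rightFace]

/-- If a labelling of the faces agrees across every edge at `v`, then all faces at `v` have the same
label. -/
theorem label_eq_of_fst_eq [Finite V] {α : Type*} {φ : R.Face → α} {v : V}
    (hφ : ∀ d : G.Dart, d.fst = v → φ (R.leftFace d) = φ (R.rightFace d)) {d d' : G.Dart}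
    (hd : d.fst = v) (hd' : d'.fst = v) : φ (R.leftFace d) = φ (R.leftFace d') := by
  obtain ⟨n, rfl⟩ := R.exists_rot_pow_eq (hd.trans hd'.symm)
  clear hd'
  induction n with
  | zero => rfl
  | succ n ih =>
    rw [ih, pow_succ', Equiv.Perm.mul_apply, hφ (R.rot _), R.face_rot]
    rw [R.rot_fst, R.rot_pow_fst, hd]

/-- The dual graph is connected: a labelling of the faces that agrees across every edge is
constant. -/
theorem face_eq_of_forall_dart [Finite V] {α : Type*} (hG : G.Connected) {φ : R.Face → α}
    (hφ : ∀ d, φ (R.leftFace d) = φ (R.rightFace d)) (f g : R.Face) : φ f = φ g := by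
  have hcyc : ∀ d d' : G.Dart, d.fst = d'.fst → φ (R.leftFace d) = φ (R.leftFace d') :=
    fun d d' h => R.label_eq_of_fst_eq (fun e _ => hφ e) h rfl
  obtain ⟨d, rfl⟩ := Quotient.exists_rep f
  obtain ⟨e, rfl⟩ := Quotient.exists_rep g
  have hv := (SimpleGraph.reachable_iff_reflTransGen _ _).1 (hG.preconnected d.fst e.fst)
  change φ (R.leftFace d) = φ (R.leftFace e)
  generalize hu : d.fst = u at hv
  induction hv using Relation.ReflTransGen.head_induction_on generalizing d with
  | refl => exact hcyc d e hu
  | @head b c hbc _ ih =>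
    have h1 := hcyc d ⟨(b, c), hbc⟩ hu
    rw [h1, hφ]
    exact ih (SimpleGraph.Dart.symm ⟨(b, c), hbc⟩) rfl

/-- On the sphere every mod 2 cycle `x` is a boundary: there is a two-colouring of the faces in
which the two sides of an edge differ exactly when the edge belongs to `x`. The boundaries are
contained in the cycles, and Euler's formula says that the two spaces have the same dimension. -/
theorem exists_face_coloring [Fintype V] [DecidableEq V] [DecidableRel G.Adj]
    (hG : G.Connected) (hE : Nat.card V + Nat.card R.Face = Nat.card G.edgeSet + 2)
    {x : Sym2 V → ZMod 2} (hx : ∀ v, ∑ d : G.Dart with d.fst = v, x d.edge = 0) :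
    ∃ φ : R.Face → ZMod 2, ∀ d, φ (R.leftFace d) + φ (R.rightFace d) = x d.edge := by
  classical
  have : Finite R.Face := inferInstanceAs (Finite (Quotient _))
  have : Fintype R.Face := Fintype.ofFinite _
  have hV : Nonempty V := hG.nonempty
  have htwo : ∀ a b : ZMod 2, a + b = 0 → a = b := by decide
  -- the mod 2 incidence matrix, written as a sum over darts
  let B : Matrix V G.edgeSet (ZMod 2) := Matrix.of fun v e =>
    ∑ d : G.Dart, if d.fst = v ∧ d.edge = e then 1 else 0
  have hB : ∀ y v, (B.mulVec y) v =
      ∑ d : G.Dart with d.fst = v, y ⟨d.edge, d.edge_mem⟩ := by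
    intro y v
    simp only [Matrix.mulVec, dotProduct, B, Matrix.of_apply, Finset.sum_mul]
    rw [Finset.sum_comm, Finset.sum_filter]
    refine Finset.sum_congr rfl fun d _ => ?_
    rw [Finset.sum_eq_single ⟨d.edge, d.edge_mem⟩]
    · by_cases h : d.fst = v <;> simp [h]
    · intro e _ he
      have : d.edge ≠ e := fun h => he (Subtype.ext h.symm)
      simp [this]
    · simp
  have hBt : ∀ y (d : G.Dart), (B.transpose.mulVec y) ⟨d.edge, d.edge_mem⟩ =
      y d.fst + y d.snd := by
    intro y d
    have : ∀ d' : G.Dart, (∑ v, (if d'.fst = v ∧ d'.edge = d.edge then (1 : ZMod 2) else 0) * y v)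
        = if d'.edge = d.edge then y d'.fst else 0 := by
      intro d'
      rw [Finset.sum_eq_single d'.fst]
      · simp
      · intro v _ hv
        simp [hv.symm]
      · simp
    simp only [Matrix.mulVec, dotProduct, B, Matrix.transpose_apply, Matrix.of_apply,
      Finset.sum_mul]
    rw [Finset.sum_comm, Finset.sum_congr rfl fun d' _ => this d', ← Finset.sum_filter,
      d.edge_fiber, Finset.sum_pair d.symm_ne.symm]
    rfl
  have hrepr : ∀ e : G.edgeSet, ∃ d : G.Dart, (⟨d.edge, d.edge_mem⟩ : G.edgeSet) = e := by
    rintro ⟨⟨u, v⟩, h⟩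
    exact ⟨⟨(u, v), h⟩, rfl⟩
  choose o ho using hrepr
  -- the boundary map from sets of faces to sets of edges
  let δ : (R.Face → ZMod 2) →ₗ[ZMod 2] (G.edgeSet → ZMod 2) :=
    { toFun := fun φ e => φ (R.leftFace (o e)) + φ (R.rightFace (o e))
      map_add' := by
        intro φ ψ
        funext e
        simp only [Pi.add_apply]
        ring
      map_smul' := by
        intro c φ
        funext e
        simp only [Pi.smul_apply, smul_eq_mul, RingHom.id_apply]
        ring }
  have hδ : ∀ φ (d : G.Dart), δ φ ⟨d.edge, d.edge_mem⟩ =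
      φ (R.leftFace d) + φ (R.rightFace d) := by
    intro φ d
    have h := congrArg Subtype.val (ho ⟨d.edge, d.edge_mem⟩)
    change φ (R.leftFace (o _)) + φ (R.rightFace (o _)) = _
    rcases (SimpleGraph.dart_edge_eq_iff _ _).1 h with h | h
    · rw [h]
    · rw [h, R.rightFace_symm, add_comm]
      rfl
  have hle : δ.range ≤ B.mulVecLin.ker := by
    rintro _ ⟨φ, rfl⟩
    rw [LinearMap.mem_ker]
    funext v
    rw [Matrix.mulVecLin_apply, hB, Finset.sum_congr rfl fun d _ => hδ φ d,
      Finset.sum_add_distrib]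
    -- rotation about `v` matches the right faces with the left faces
    have : ∑ d : G.Dart with d.fst = v, φ (R.leftFace d) =
        ∑ d : G.Dart with d.fst = v, φ (R.rightFace d) := by
      refine Finset.sum_equiv R.rot (fun d => ?_) fun d _ => ?_
      · simp [R.rot_fst]
      · rw [R.face_rot]
    rw [this]
    exact CharTwo.add_self_eq_zero _
  have hker1 : Module.finrank (ZMod 2) δ.ker ≤ 1 := by
    refine finrank_le_one ⟨fun _ => 1, ?_⟩ ?_
    · rw [LinearMap.mem_ker]
      funext e
      exact CharTwo.add_self_eq_zero (1 : ZMod 2)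
    · rintro ⟨φ, hφ⟩
      rw [LinearMap.mem_ker] at hφ
      have hc := R.face_eq_of_forall_dart hG (φ := φ) fun d => by
        have := congrFun hφ ⟨d.edge, d.edge_mem⟩
        rw [hδ] at this
        exact htwo _ _ this
      rcases isEmpty_or_nonempty R.Face with hF | ⟨⟨f⟩⟩
      · exact ⟨0, Subtype.ext (funext fun f => (hF.false f).elim)⟩
      · refine ⟨φ f, Subtype.ext (funext fun g => ?_)⟩
        simpa using hc f g
  have hker2 : Module.finrank (ZMod 2) B.transpose.mulVecLin.ker ≤ 1 := by
    refine finrank_le_one ⟨fun _ => 1, ?_⟩ ?_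
    · rw [LinearMap.mem_ker]
      funext e
      obtain ⟨d, rfl⟩ : ∃ d : G.Dart, (⟨d.edge, d.edge_mem⟩ : G.edgeSet) = e := ⟨o e, ho e⟩
      rw [Matrix.mulVecLin_apply, hBt]
      exact CharTwo.add_self_eq_zero (1 : ZMod 2)
    · rintro ⟨y, hy⟩
      rw [LinearMap.mem_ker] at hy
      have hc := hG.eq_of_forall_adj (f := y) fun u v huv => by
        have := congrFun hy ⟨SimpleGraph.Dart.edge ⟨(u, v), huv⟩, SimpleGraph.Dart.edge_mem _⟩
        rw [Matrix.mulVecLin_apply, hBt y ⟨(u, v), huv⟩] at this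
        exact htwo _ _ this
      obtain ⟨v⟩ := hV
      refine ⟨y v, Subtype.ext (funext fun w => ?_)⟩
      simpa using hc v w
  have h1 := δ.finrank_range_add_finrank_ker
  have h2 := B.mulVecLin.finrank_range_add_finrank_ker
  have h3 := B.transpose.mulVecLin.finrank_range_add_finrank_ker
  have h4 : Module.finrank (ZMod 2) B.transpose.mulVecLin.range =
      Module.finrank (ZMod 2) B.mulVecLin.range := B.rank_transpose
  rw [Module.finrank_fintype_fun_eq_card] at h1 h2 h3
  rw [Nat.card_eq_fintype_card, Nat.card_eq_fintype_card, Nat.card_eq_fintype_card] at hE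
  have heq := Submodule.eq_of_le_of_finrank_le hle (by omega)
  have hmem : (fun e : G.edgeSet => x e) ∈ δ.range := by
    rw [heq, LinearMap.mem_ker]
    funext v
    rw [Matrix.mulVecLin_apply, hB]
    exact hx v
  obtain ⟨φ, hφ⟩ := hmem
  exact ⟨φ, fun d => by rw [← hδ, hφ]⟩

end RotationSystem

/-! ### A discrete Jordan curve theorem -/

/-- The edges of a walk from `u` to `w` have even degree, apart from the endpoints. -/
theorem SimpleGraph.Walk.sum_count_edges {V : Type*} {G : SimpleGraph V} [Fintype V]
    [DecidableEq V] [DecidableRel G.Adj] {u w : V} (p : G.Walk u w) (v : V) :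
    ∑ d : G.Dart with d.fst = v, (p.edges.count d.edge : ZMod 2) =
      (if v = u then 1 else 0) + (if v = w then 1 else 0) := by
  induction p with
  | nil => simp [CharTwo.add_self_eq_zero]
  | @cons a b c h p ih =>
    have key : ∑ d : G.Dart with d.fst = v, (if s(a, b) = d.edge then 1 else 0 : ZMod 2) =
        (if v = a then 1 else 0) + (if v = b then 1 else 0) := by
      let e : G.Dart := ⟨(a, b), h⟩
      have : ∀ d : G.Dart, s(a, b) = d.edge ↔ d = e ∨ d = e.symm := fun d =>
        eq_comm.trans (SimpleGraph.dart_edge_eq_iff d e)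
      rw [Finset.sum_filter]
      calc ∑ d : G.Dart, (if d.fst = v then (if s(a, b) = d.edge then 1 else 0 : ZMod 2) else 0)
          = ∑ d ∈ {e, e.symm}, (if d.fst = v then 1 else 0 : ZMod 2) := by
            rw [← Finset.sum_subset (Finset.subset_univ {e, e.symm})]
            · refine Finset.sum_congr rfl fun d hd => ?_
              rw [if_pos ((this d).2 (by simpa using hd))]
            · intro d _ hd
              rw [if_neg fun h : s(a, b) = d.edge => hd (by simpa using (this d).1 h), ite_self]
        _ = _ := by
            rw [Finset.sum_pair e.symm_ne.symm]
            simp only [e, SimpleGraph.Dart.symm_mk, Prod.swap_prod_mk, eq_comm]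
    simp only [SimpleGraph.Walk.edges_cons, List.count_cons, Nat.cast_add, Finset.sum_add_distrib,
      ih, beq_iff_eq, Nat.cast_ite, Nat.cast_one, Nat.cast_zero, key]
    generalize (if v = a then (1 : ZMod 2) else 0) = x
    generalize (if v = b then (1 : ZMod 2) else 0) = y
    generalize (if v = c then (1 : ZMod 2) else 0) = z
    revert x y z
    decide

namespace SimpleGraph.Walk

variable {V : Type*} {G : SimpleGraph V} {u : V} {c : G.Walk u u}

theorem IsCycle.dart_eq_of_fst_eq (hc : c.IsCycle) {d e : G.Dart} (hd : d ∈ c.darts)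
    (he : e ∈ c.darts) (h : d.fst = e.fst) : d = e :=
  List.inj_on_of_nodup_map (c.map_fst_darts ▸ hc.nodup_dropLast_support) hd he h

theorem IsCycle.dart_eq_of_snd_eq (hc : c.IsCycle) {d e : G.Dart} (hd : d ∈ c.darts)
    (he : e ∈ c.darts) (h : d.snd = e.snd) : d = e :=
  List.inj_on_of_nodup_map (c.map_snd_darts ▸ hc.support_nodup) hd he h

theorem IsCycle.symm_notMem_darts (hc : c.IsCycle) {d : G.Dart} (hd : d ∈ c.darts) :
    d.symm ∉ c.darts := fun h =>
  d.symm_ne (List.inj_on_of_nodup_map (f := SimpleGraph.Dart.edge) hc.edges_nodup h hd d.edge_symm)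

/-- The only edges of a cycle at a vertex that it passes, entering along `d` and leaving along
`e`, are those of `d` and `e`. -/
theorem IsCycle.eq_or_eq_of_edge_mem (hc : c.IsCycle) {d e g : G.Dart} (hd : d ∈ c.darts)
    (he : e ∈ c.darts) (hde : d.snd = e.fst) (hg : g.edge ∈ c.edges) (hge : g.fst = e.fst) :
    g = e ∨ g = d.symm := by
  obtain ⟨g', hg', h⟩ := List.mem_map.1 hg
  rcases (SimpleGraph.dart_edge_eq_iff _ _).1 h with rfl | rfl
  · exact Or.inl (hc.dart_eq_of_fst_eq hg' he hge)
  · right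
    rw [← hc.dart_eq_of_snd_eq hg' hd (hge.trans hde.symm), SimpleGraph.Dart.symm_symm]

end SimpleGraph.Walk

namespace RotationSystem

variable {V : Type*} {G : SimpleGraph V} (R : RotationSystem G)

/-- `R.Between e k g` says that the corner just counterclockwise of the dart `k` lies in the
sector swept by turning counterclockwise from the dart `e` to the dart `g`. -/
def Between (e k g : G.Dart) : Prop :=
  ∃ n : ℕ, (R.rot ^ n) e = k ∧ ∀ i ≤ n, (R.rot ^ i) e ≠ g

theorem between_or_between [Finite V] {e k g : G.Dart} (hek : e.fst = k.fst)
    (hgk : g.fst = k.fst) (hne : e ≠ g) : R.Between e k g ∨ R.Between g k e := by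
  classical
  -- take the first of the two darts met when turning clockwise from `k`
  obtain ⟨n, hn⟩ := R.exists_rot_pow_eq hek
  obtain ⟨m, hm⟩ := R.exists_rot_pow_eq hgk
  have hen := Nat.find_spec (⟨n, hn⟩ : ∃ n, (R.rot ^ n) e = k)
  have hgm := Nat.find_spec (⟨m, hm⟩ : ∃ m, (R.rot ^ m) g = k)
  have hemin := fun i => Nat.find_min (m := i) (⟨n, hn⟩ : ∃ n, (R.rot ^ n) e = k)
  have hgmin := fun i => Nat.find_min (m := i) (⟨m, hm⟩ : ∃ m, (R.rot ^ m) g = k)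
  generalize Nat.find (⟨n, hn⟩ : ∃ n, (R.rot ^ n) e = k) = n' at hen hemin
  generalize Nat.find (⟨m, hm⟩ : ∃ m, (R.rot ^ m) g = k) = m' at hgm hgmin
  have hsplit : ∀ (a b : ℕ) (p q : G.Dart), (R.rot ^ b) p = k → a ≤ b → (R.rot ^ a) p = q →
      (R.rot ^ (b - a)) q = k := by
    rintro a b p q h hab rfl
    rw [← Equiv.Perm.mul_apply, ← pow_add, Nat.sub_add_cancel hab, h]
  rcases le_total n' m' with hnm | hnm
  · refine Or.inl ⟨n', hen, fun i hi h => ?_⟩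
    rcases Nat.eq_zero_or_pos i with rfl | hpos
    · exact hne h
    · exact hgmin (n' - i) (by omega) (hsplit i n' e g hen hi h)
  · refine Or.inr ⟨m', hgm, fun i hi h => ?_⟩
    rcases Nat.eq_zero_or_pos i with rfl | hpos
    · exact hne h.symm
    · exact hemin (m' - i) (by omega) (hsplit i m' g e hgm hi h)

variable {R} {φ : R.Face → ZMod 2}

/-- A face colouring does not change inside a sector bounded by the only two darts at which it
is allowed to change. -/
theorem Between.color_eq {e k g : G.Dart} (h : R.Between e k g)
    (hφ : ∀ d : G.Dart, d.fst = e.fst → d ≠ e → d ≠ g →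
      φ (R.leftFace d) = φ (R.rightFace d)) :
    φ (R.leftFace k) = φ (R.leftFace e) := by
  obtain ⟨n, rfl, hn⟩ := h
  induction n with
  | zero => rfl
  | succ n ih =>
    by_cases he : (R.rot ^ (n + 1)) e = e
    · rw [he]
    · rw [hφ _ (R.rot_pow_fst e _) he (hn _ le_rfl), ← ih fun i hi => hn i (by omega),
        pow_succ', Equiv.Perm.mul_apply, R.face_rot]

theorem color_left_eq_color_right [Finite V] {e g : G.Dart} (heg : e.fst = g.fst) (hne : e ≠ g)
    (hφ : ∀ d : G.Dart, d.fst = e.fst → d ≠ e → d ≠ g →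
      φ (R.leftFace d) = φ (R.rightFace d)) :
    φ (R.leftFace e) = φ (R.rightFace g) := by
  classical
  have hex := R.exists_rot_pow_eq heg
  obtain ⟨n, hn, hmin⟩ : ∃ n, (R.rot ^ n) e = g ∧ ∀ i < n, (R.rot ^ i) e ≠ g :=
    ⟨Nat.find hex, Nat.find_spec hex, fun i hi => Nat.find_min hex hi⟩
  cases n with
  | zero => exact absurd hn hne
  | succ n =>
    have hb : R.Between e ((R.rot ^ n) e) g := ⟨n, rfl, fun i hi => hmin i (by omega)⟩
    rw [← hb.color_eq hφ, ← R.face_rot, ← Equiv.Perm.mul_apply, ← pow_succ', hn]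

/-- The colour on the left-hand side is constant along a chain of darts of a cycle. -/
theorem color_left_eq_of_isChain [Finite V] {u : V} {c : G.Walk u u} (hc : c.IsCycle)
    (hφ : ∀ d : G.Dart, d.edge ∉ c.edges → φ (R.leftFace d) = φ (R.rightFace d))
    (l : List G.Dart) (d : G.Dart) (hl : (d :: l).IsChain G.DartAdj)
    (hlc : ∀ e ∈ d :: l, e ∈ c.darts) (e : G.Dart) (he : e ∈ d :: l) :
    φ (R.leftFace e) = φ (R.leftFace d) := by
  induction l generalizing d with
  | nil => rw [List.mem_singleton.1 he]
  | cons d' l ih =>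
    rcases List.mem_cons.1 he with rfl | he
    · rfl
    rw [List.isChain_cons_cons] at hl
    rw [ih d' hl.2 (fun e he => hlc e (List.mem_cons_of_mem _ he)) he]
    have hd : d ∈ c.darts := hlc d (by simp)
    have hd' : d' ∈ c.darts := hlc d' (by simp)
    have hadj : d.snd = d'.fst := hl.1
    have := color_left_eq_color_right (φ := φ) (e := d') (g := d.symm) hadj.symm
      (fun h => hc.symm_notMem_darts hd (h ▸ hd')) fun g hg h1 h2 => hφ g fun hmem =>
        (hc.eq_or_eq_of_edge_mem hd hd' hadj hmem hg).elim h1 h2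
    rw [this]
    simp [RotationSystem.rightFace]

end RotationSystem

/-- Two vertices adjacent to a connected set `U` are joined by a path through `U` with prescribed
first and last edges. -/
theorem SimpleGraph.exists_isPath_through {V : Type*} {G : SimpleGraph V} {U : Set V}
    (hU : (G.induce U).Preconnected) {d e : G.Dart} (hd : d.snd ∈ U) (he : e.snd ∈ U)
    (hdU : d.fst ∉ U) (heU : e.fst ∉ U) (hne : d.fst ≠ e.fst) :
    ∃ p : G.Walk d.fst e.fst, p.IsPath ∧ (∃ l, p.darts = d :: l ∧ e.symm ∈ l) ∧
      ∀ v ∈ p.support.tail, v ∈ U ∨ v = e.fst := by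
  classical
  obtain ⟨q⟩ := hU ⟨d.snd, hd⟩ ⟨e.snd, he⟩
  let r : G.Walk d.snd e.snd := q.toPath.1.map (SimpleGraph.Embedding.induce U).toHom
  have hr : r.IsPath :=
    q.toPath.2.map (SimpleGraph.Embedding.induce (G := G) U).injective
  have hrU : ∀ v ∈ r.support, v ∈ U := by
    intro v hv
    obtain ⟨w, _, rfl⟩ := List.mem_map.1 ((congrArg (v ∈ ·) (SimpleGraph.Walk.support_map
      (SimpleGraph.Embedding.induce U).toHom q.toPath.1)).mp hv)
    exact w.2
  refine ⟨.cons d.adj (r.concat e.adj.symm), ?_, ⟨(r.concat e.adj.symm).darts, ?_, ?_⟩, ?_⟩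
  · rw [SimpleGraph.Walk.cons_isPath_iff, SimpleGraph.Walk.concat_isPath_iff]
    refine ⟨⟨hr, fun h => heU (hrU _ h)⟩, fun h => ?_⟩
    simp only [SimpleGraph.Walk.support_concat, List.mem_append,
      List.mem_singleton] at h
    exact h.elim (fun h => hdU (hrU _ h)) hne
  · rfl
  · simp only [SimpleGraph.Walk.darts_concat, List.concat_eq_append, List.mem_append,
      List.mem_singleton]
    exact Or.inr rfl
  · intro v hv
    simp only [SimpleGraph.Walk.support_cons, List.tail_cons, SimpleGraph.Walk.support_concat,
      List.mem_append, List.mem_singleton] at hv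
    exact hv.imp_left (hrU v)

namespace RotationSystem

variable {V : Type*} {G : SimpleGraph V} (R : RotationSystem G)

/-- Let two vertices be joined by disjoint connected sets `U` and `D`. A corner at the first
vertex and one at the second, each in the sector from `U` counterclockwise to `D`, lie on opposite
sides of a cycle running through `U` and `D`. -/
theorem exists_coloring_ne [Fintype V] [DecidableEq V] [DecidableRel G.Adj]
    (hG : G.Connected) (hE : Nat.card V + Nat.card R.Face = Nat.card G.edgeSet + 2)
    {U D : Set V} (hU : (G.induce U).Preconnected) (hD : (G.induce D).Preconnected)
    (hUD : Disjoint U D) {u₁ d₁ k₁ u₂ d₂ k₂ : G.Dart} (h₁ : d₁.fst = u₁.fst)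
    (h₂ : d₂.fst = u₂.fst) (hne : u₁.fst ≠ u₂.fst) (hU₁ : u₁.fst ∉ U) (hU₂ : u₂.fst ∉ U)
    (hD₁ : u₁.fst ∉ D) (hD₂ : u₂.fst ∉ D) (hu₁ : u₁.snd ∈ U) (hu₂ : u₂.snd ∈ U)
    (hd₁ : d₁.snd ∈ D) (hd₂ : d₂.snd ∈ D) (hb₁ : R.Between u₁ k₁ d₁)
    (hb₂ : R.Between u₂ k₂ d₂) :
    ∃ φ : R.Face → ZMod 2, φ (R.leftFace k₁) ≠ φ (R.leftFace k₂) ∧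
      ∀ d : G.Dart, d.fst ∉ U → d.fst ∉ D → d.fst ≠ u₁.fst → d.fst ≠ u₂.fst →
        φ (R.leftFace d) = φ (R.rightFace d) := by
  obtain ⟨p, hp, ⟨l, hl, hul⟩, hpU⟩ := SimpleGraph.exists_isPath_through hU hu₁ hu₂ hU₁ hU₂ hne
  have hq := SimpleGraph.exists_isPath_through hD hd₂ hd₁ (h₂ ▸ hD₂) (h₁ ▸ hD₁)
    (by rw [h₁, h₂]; exact hne.symm)
  rw [h₁, h₂] at hq
  obtain ⟨q, hq, ⟨m, hm, hdm⟩, hqD⟩ := hq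
  have hlen : 1 < p.length := by
    rw [← p.length_darts, hl, List.length_cons]
    have := List.length_pos_of_mem hul
    omega
  have hc : (p.append q).IsCycle := by
    refine hp.isCycle_append hq (fun v hv hv' => ?_) (Or.inl hlen)
    rcases hpU v hv with h | rfl <;> rcases hqD _ hv' with h' | h'
    · exact Set.disjoint_left.1 hUD h h'
    · exact hU₁ (h' ▸ h)
    · exact hD₂ h'
    · exact hne h'.symm
  obtain ⟨φ, hφ⟩ := R.exists_face_coloring hG hE
    (x := fun e => ((p.append q).edges.count e : ZMod 2)) fun v => by
      rw [SimpleGraph.Walk.sum_count_edges, CharTwo.add_self_eq_zero]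
  generalize hcc : p.append q = c at *
  have hdc : c.darts = (u₁ :: l) ++ (d₂ :: m) := by
    rw [← hcc, SimpleGraph.Walk.darts_append, hl, hm]
  have hout : ∀ d : G.Dart, d.edge ∉ c.edges → φ (R.leftFace d) = φ (R.rightFace d) := by
    intro d hd
    have := hφ d
    rw [List.count_eq_zero_of_not_mem hd] at this
    exact (by decide : ∀ a b : ZMod 2, a + b = ((0 : ℕ) : ZMod 2) → a = b) _ _ this
  have hin : ∀ d : G.Dart, d.edge ∈ c.edges → φ (R.leftFace d) ≠ φ (R.rightFace d) := by
    intro d hd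
    have := hφ d
    rw [List.count_eq_one_of_mem hc.edges_nodup hd] at this
    exact (by decide : ∀ a b : ZMod 2, a + b = ((1 : ℕ) : ZMod 2) → a ≠ b) _ _ this
  have mu₁ : u₁ ∈ c.darts := by rw [hdc]; simp
  have md₂ : d₂ ∈ c.darts := by rw [hdc]; simp
  have mu₂ : u₂.symm ∈ c.darts := by rw [hdc]; simp [hul]
  have md₁ : d₁.symm ∈ c.darts := by rw [hdc]; simp [hdm]
  have hk₁ : φ (R.leftFace k₁) = φ (R.leftFace u₁) :=
    hb₁.color_eq fun g hg hg1 hg2 => hout g fun hmem =>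
      (hc.eq_or_eq_of_edge_mem md₁ mu₁ h₁ hmem hg).elim hg1 fun h => hg2 (by simpa using h)
  have hk₂ : φ (R.leftFace k₂) = φ (R.leftFace u₂) :=
    hb₂.color_eq fun g hg hg1 hg2 => hout g fun hmem =>
      (hc.eq_or_eq_of_edge_mem mu₂ md₂ h₂.symm hmem (hg.trans h₂.symm)).elim hg2
        fun h => hg1 (by simpa using h)
  have hleft : φ (R.leftFace u₂.symm) = φ (R.leftFace u₁) :=
    color_left_eq_of_isChain hc hout l u₁ (hl ▸ p.isChain_dartAdj_darts)
      (fun e he => by rw [hdc]; exact List.mem_append_left _ he) _ (List.mem_cons_of_mem _ hul)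
  refine ⟨φ, ?_, fun d hdU hdD hd1 hd2 => hout d fun hmem => ?_⟩
  · rw [hk₁, hk₂, ← hleft]
    have hmem : u₂.edge ∈ c.edges := by
      rw [← SimpleGraph.Dart.edge_symm]
      exact List.mem_map_of_mem mu₂
    exact (hin u₂ hmem).symm
  · have hs : d.fst ∈ c.support :=
      c.fst_mem_support_of_mem_edges (t := d.fst) (u := d.snd) hmem
    rw [← hcc, SimpleGraph.Walk.mem_support_append_iff, p.mem_support_iff, q.mem_support_iff] at hs
    rcases hs with (h | h) | (h | h)
    · exact hd1 h
    · exact (hpU _ h).elim hdU hd2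
    · exact hd2 h
    · exact (hqD _ h).elim hdD hd1

/-- A form of the nonplanarity of `K₃,₃`: let three vertices be adjacent to each of two disjoint
connected sets `U` and `D`, and choose a corner at each of them. Then two of the corners are
separated by a cycle in `U`, `D` and the three vertices. Applied to corners of one face, or to
corners next to a third connected set, this is a contradiction. -/
theorem exists_coloring_ne_of_three [Fintype V] [DecidableEq V] [DecidableRel G.Adj]
    (hG : G.Connected) (hE : Nat.card V + Nat.card R.Face = Nat.card G.edgeSet + 2)
    {U D : Set V} (hU : (G.induce U).Preconnected) (hD : (G.induce D).Preconnected)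
    (hUD : Disjoint U D) (k : Fin 3 → G.Dart) (hk : Function.Injective fun i => (k i).fst)
    (hkU : ∀ i, (k i).fst ∉ U) (hkD : ∀ i, (k i).fst ∉ D)
    (hu : ∀ i, ∃ w ∈ U, G.Adj (k i).fst w) (hd : ∀ i, ∃ w ∈ D, G.Adj (k i).fst w) :
    ∃ i j, ∃ φ : R.Face → ZMod 2, φ (R.leftFace (k i)) ≠ φ (R.leftFace (k j)) ∧
      ∀ d : G.Dart, d.fst ∉ U → d.fst ∉ D → (∀ i, d.fst ≠ (k i).fst) →
        φ (R.leftFace d) = φ (R.rightFace d) := by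
  have hu' : ∀ i, ∃ e : G.Dart, e.fst = (k i).fst ∧ e.snd ∈ U := fun i =>
    let ⟨w, hw, h⟩ := hu i
    ⟨⟨(_, w), h⟩, rfl, hw⟩
  have hd' : ∀ i, ∃ e : G.Dart, e.fst = (k i).fst ∧ e.snd ∈ D := fun i =>
    let ⟨w, hw, h⟩ := hd i
    ⟨⟨(_, w), h⟩, rfl, hw⟩
  choose u hu1 hu2 using hu'
  choose d hd1 hd2 using hd'
  have hbtw : ∀ i, R.Between (u i) (k i) (d i) ∨ R.Between (d i) (k i) (u i) := fun i =>
    R.between_or_between (hu1 i) (hd1 i) fun h =>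
      Set.disjoint_left.1 hUD (hu2 i) (h ▸ hd2 i)
  classical
  -- two of the three vertices see `U`, the corner and `D` in the same cyclic order
  obtain ⟨i, j, hij, hsame⟩ := Fintype.exists_ne_map_eq_of_card_lt
    (fun i : Fin 3 => decide (R.Between (u i) (k i) (d i))) (by simp)
  have hne : (k i).fst ≠ (k j).fst := hk.ne hij
  refine ⟨i, j, ?_⟩
  by_cases h : R.Between (u i) (k i) (d i)
  · have h' : R.Between (u j) (k j) (d j) := by simpa [h] using hsame
    obtain ⟨φ, h1, h2⟩ := R.exists_coloring_ne hG hE hU hD hUD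
      ((hd1 i).trans (hu1 i).symm) ((hd1 j).trans (hu1 j).symm) (by rwa [hu1, hu1])
      (by rw [hu1]; exact hkU i) (by rw [hu1]; exact hkU j) (by rw [hu1]; exact hkD i)
      (by rw [hu1]; exact hkD j) (hu2 i) (hu2 j) (hd2 i) (hd2 j) h h'
    exact ⟨φ, h1, fun e heU heD he => h2 e heU heD (by rw [hu1]; exact he i)
      (by rw [hu1]; exact he j)⟩
  · have h' : ¬ R.Between (u j) (k j) (d j) := by simpa [h] using hsame
    obtain ⟨φ, h1, h2⟩ := R.exists_coloring_ne hG hE hD hU hUD.symm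
      ((hu1 i).trans (hd1 i).symm) ((hu1 j).trans (hd1 j).symm) (by rwa [hd1, hd1])
      (by rw [hd1]; exact hkD i) (by rw [hd1]; exact hkD j) (by rw [hd1]; exact hkU i)
      (by rw [hd1]; exact hkU j) (hd2 i) (hd2 j) (hu2 i) (hu2 j)
      ((hbtw i).resolve_left h) ((hbtw j).resolve_left h')
    exact ⟨φ, h1, fun e heU heD he => h2 e heD heU (by rw [hd1]; exact he i)
      (by rw [hd1]; exact he j)⟩

end RotationSystem

/-! ### Harmonic functions on 3-connected graphs -/

namespace IsThreeConnected

variable {V : Type*} {G : SimpleGraph V}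

/-- Every vertex set has a boundary edge avoiding two given vertices. -/
theorem exists_adj_of_mem_of_notMem (hG : IsThreeConnected G) {S : Set V} {a b p q : V}
    (ha : a ∈ S) (hb : b ∉ S) (hap : a ≠ p) (haq : a ≠ q) (hbp : b ≠ p) (hbq : b ≠ q) :
    ∃ x ∈ S, ∃ y ∉ S, G.Adj x y ∧ y ≠ p ∧ y ≠ q := by
  by_contra! hcon
  have hne : ∀ y : ({p, q}ᶜ : Set V), y.1 ≠ p ∧ y.1 ≠ q := fun y => not_or.1 y.2
  have hiff := (hG p q).eq_of_forall_adj (f := fun x : ({p, q}ᶜ : Set V) => x.1 ∈ S)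
    (fun x y hxy => by
      have hxy : G.Adj x.1 y.1 := hxy
      refine propext ⟨fun h => ?_, fun h => ?_⟩
      · by_contra hy
        exact (hne y).2 (hcon x.1 h y.1 hy hxy (hne y).1)
      · by_contra hx
        exact (hne x).2 (hcon y.1 h x.1 hx hxy.symm (hne x).1))
    ⟨a, by simp [hap, haq]⟩ ⟨b, by simp [hbp, hbq]⟩
  exact hb (hiff ▸ ha)

theorem exists_adj_ne (hG : IsThreeConnected G) {v u : V} (h : v ≠ u) :
    ∃ w, G.Adj v w ∧ w ≠ u := by
  obtain ⟨b, hb⟩ := (hG v u).nonempty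
  simp only [Set.mem_compl_iff, Set.mem_insert_iff, Set.mem_singleton_iff, not_or] at hb
  obtain ⟨x, rfl, y, _, hxy, hy, _⟩ :=
    hG.exists_adj_of_mem_of_notMem (S := {v}) rfl hb.1 h h hb.2 hb.2
  exact ⟨y, hxy, hy⟩

end IsThreeConnected

/-- `f` satisfies Kirchhoff's law at all vertices of `G` other than `s` and `t`. -/
def IsHarmonicOff {V : Type*} [Fintype V] [DecidableEq V] (G : SimpleGraph V) [DecidableRel G.Adj]
    (s t : V) (f : V → ℝ) : Prop :=
  ∀ x, x ≠ s → x ≠ t → ∑ d : G.Dart with d.fst = x, (f x - f d.snd) = 0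

namespace IsHarmonicOff

variable {V : Type*} [Fintype V] [DecidableEq V] {G : SimpleGraph V} [DecidableRel G.Adj]
  {s t : V} {f : V → ℝ}

theorem neg (hf : IsHarmonicOff G s t f) : IsHarmonicOff G t s (-f) := by
  intro x ht hs
  have := hf x hs ht
  rw [← neg_eq_zero, ← Finset.sum_neg_distrib] at this
  rw [← this]
  exact Finset.sum_congr rfl fun d _ => by simp only [Pi.neg_apply]; ring

theorem eq_of_forall_adj_le (hf : IsHarmonicOff G s t f) {x : V} (hs : x ≠ s) (ht : x ≠ t)
    (hx : ∀ y, G.Adj x y → f y ≤ f x) (y : V) (hxy : G.Adj x y) : f y = f x := by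
  have h := (Finset.sum_eq_zero_iff_of_nonneg fun d hd => by
    obtain rfl := (Finset.mem_filter.1 hd).2
    linarith [hx d.snd d.adj]).1 (hf x hs ht) ⟨(x, y), hxy⟩ (by simp)
  simp only at h
  linarith

theorem exists_adj_gt (hf : IsHarmonicOff G s t f) {x y : V} (hs : x ≠ s) (ht : x ≠ t)
    (hxy : G.Adj x y) (hne : f y ≠ f x) : ∃ z, G.Adj x z ∧ f x < f z := by
  by_contra! h
  exact hne (hf.eq_of_forall_adj_le hs ht h y hxy)

theorem exists_adj_lt (hf : IsHarmonicOff G s t f) {x y : V} (hs : x ≠ s) (ht : x ≠ t)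
    (hxy : G.Adj x y) (hne : f y ≠ f x) : ∃ z, G.Adj x z ∧ f z < f x := by
  obtain ⟨z, hz, h⟩ := hf.neg.exists_adj_gt ht hs hxy (by simpa using hne)
  exact ⟨z, hz, by simpa using h⟩

/-- Maximum principle: from a set of vertices that avoids `s` and `t` one can leave through a
vertex where `f` is maximal, without going down. -/
theorem exists_exit (hf : IsHarmonicOff G s t f) (hG : G.Connected) {R : Set V}
    (hR : R.Nonempty) (hs : s ∉ R) (ht : t ∉ R) :
    ∃ v ∈ R, ∃ w ∉ R, G.Adj v w ∧ (∀ u ∈ R, f u ≤ f v) ∧ f v ≤ f w := by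
  by_contra! hcon
  obtain ⟨m, hm, hmax⟩ := Set.exists_max_image R f R.toFinite hR
  have hstep : ∀ v w, G.Adj v w → v ∈ R ∧ f v = f m → w ∈ R ∧ f w = f m := by
    rintro v w hvw ⟨hv, hvm⟩
    have hout : ∀ y, y ∉ R → G.Adj v y → f y < f v := fun y hy hvy =>
      hcon v hv y hy hvy fun u hu => hvm ▸ hmax u hu
    have heq := hf.eq_of_forall_adj_le (x := v) (fun h => hs (h ▸ hv)) (fun h => ht (h ▸ hv))
      (fun y hvy => by
        by_cases hy : y ∈ R
        · exact hvm ▸ hmax y hy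
        · exact (hout y hy hvy).le) w hvw
    refine ⟨?_, heq.trans hvm⟩
    by_contra hw
    exact (hout w hw hvw).ne heq
  have := hG.eq_of_forall_adj (f := fun v => v ∈ R ∧ f v = f m)
    (fun v w h => propext ⟨hstep v w h, hstep w v h.symm⟩) m s
  exact hs (this ▸ ⟨hm, rfl⟩ : s ∈ R ∧ f s = f m).1

theorem le_source (hf : IsHarmonicOff G s t f) (hG : G.Connected) (hts : f t < f s) (v : V) :
    f v ≤ f s := by
  by_contra! hv
  obtain ⟨x, hx, y, hy, -, -, h⟩ := hf.exists_exit hG (R := {x | f s < f x}) ⟨v, hv⟩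
    (fun h : f s < f s => lt_irrefl _ h) (fun h : f s < f t => lt_asymm h hts)
  exact hy (lt_of_lt_of_le hx h)

theorem lt_source (hf : IsHarmonicOff G s t f) (hG : G.Connected) (h3 : IsThreeConnected G)
    (hts : f t < f s) {v : V} (hv : v ≠ s) : f v < f s := by
  refine (hf.le_source hG hts v).lt_of_ne fun h => ?_
  have hst : t ≠ s := fun h => hts.ne (congrArg f h)
  obtain ⟨x, hx, y, hy, hxy, hys, -⟩ := h3.exists_adj_of_mem_of_notMem
    (S := {x | x ≠ s ∧ f x = f s}) (b := t) ⟨hv, h⟩ (fun h => hts.ne h.2) hv hv hst hst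
  refine hy ⟨hys, ?_⟩
  rw [← hx.2]
  exact hf.eq_of_forall_adj_le hx.1 (fun h => hts.ne (h ▸ hx.2))
    (fun z _ => hx.2 ▸ hf.le_source hG hts z) y hxy

theorem sink_lt (hf : IsHarmonicOff G s t f) (hG : G.Connected) (h3 : IsThreeConnected G)
    (hts : f t < f s) {v : V} (hv : v ≠ t) : f t < f v := by
  simpa using hf.neg.lt_source hG h3 (by simpa using hts) hv

/-- An edge along which `f` does not change is not incident to `s` or `t`. -/
theorem ne_of_adj_of_eq (hf : IsHarmonicOff G s t f) (hG : G.Connected)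
    (h3 : IsThreeConnected G) (hts : f t < f s) {u v : V} (huv : G.Adj u v) (h : f u = f v) :
    u ≠ s ∧ u ≠ t := by
  constructor
  · rintro rfl
    exact (hf.lt_source hG h3 hts huv.ne').ne h.symm
  · rintro rfl
    exact (hf.sink_lt hG h3 hts huv.ne').ne h

theorem preconnected_superlevel (hf : IsHarmonicOff G s t f) (hG : G.Connected) {c : ℝ}
    (ht : f t ≤ c) (hs : c < f s) : (G.induce {v | c < f v}).Preconnected := by
  have key : ∀ v : {v | c < f v}, (G.induce {v | c < f v}).Reachable v ⟨s, hs⟩ := by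
    by_contra! hcon
    obtain ⟨v, hv⟩ := hcon
    -- among the vertices not linked to `s`, one of maximal height has a neighbour not below it
    obtain ⟨x, ⟨hx, hxs⟩, y, hy, hxy, -, h⟩ := hf.exists_exit hG
      (R := {x | ∃ hx : c < f x, ¬ (G.induce {v | c < f v}).Reachable ⟨x, hx⟩ ⟨s, hs⟩})
      ⟨v, v.2, hv⟩ (fun ⟨_, h⟩ => h (SimpleGraph.Reachable.refl _))
      (fun ⟨h, _⟩ => absurd h ht.not_gt)
    have hyc : c < f y := lt_of_lt_of_le hx h
    have hys : (G.induce {v | c < f v}).Reachable ⟨y, hyc⟩ ⟨s, hs⟩ := by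
      by_contra hys
      exact hy ⟨hyc, hys⟩
    have hadj : (G.induce {v | c < f v}).Adj ⟨x, hx⟩ ⟨y, hyc⟩ := hxy
    exact hxs (hadj.reachable.trans hys)
  exact fun u v => (key u).trans (key v).symm

theorem preconnected_sublevel (hf : IsHarmonicOff G s t f) (hG : G.Connected) {c : ℝ}
    (ht : f t < c) (hs : c ≤ f s) : (G.induce {v | f v < c}).Preconnected := by
  have h := hf.neg.preconnected_superlevel hG (c := -c) (by simpa using hs) (by simpa using ht)
  have hset : {v | -c < (-f) v} = {v | f v < c} := by
    ext v
    simp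
  rwa [hset] at h

/-- Take the connected cluster `Z` around a vertex all of whose neighbours are at its height `c`.
By 3-connectedness at least three vertices of height `c` outside `Z` are adjacent to `Z`; these
have neighbours above and below `c`, so together with `Z` and the parts of the graph above and
below `c` they would form a `K₃,₃` minor. -/
theorem exists_adj_ne (hf : IsHarmonicOff G s t f) (R : RotationSystem G) (hG : G.Connected)
    (hE : Nat.card V + Nat.card R.Face = Nat.card G.edgeSet + 2) (h3 : IsThreeConnected G)
    (hts : f t < f s) {v : V} (hvs : v ≠ s) (hvt : v ≠ t) : ∃ w, G.Adj v w ∧ f w ≠ f v := by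
  by_contra! hcon
  obtain ⟨c, hc⟩ : ∃ c, c = f v := ⟨_, rfl⟩
  have hcs : c < f s := hc ▸ hf.lt_source hG h3 hts hvs
  have hct : f t < c := hc ▸ hf.sink_lt hG h3 hts hvt
  -- `Z` is the connected component of `v` in the set of vertices with a flat neighbourhood at
  -- height `c`
  let Flat : Set V := {x | f x = c ∧ ∀ y, G.Adj x y → f y = c}
  let Z : Set V := {x | Relation.ReflTransGen (fun a b => G.Adj a b ∧ b ∈ Flat) v x}
  have hvZ : v ∈ Z := Relation.ReflTransGen.refl
  have hZ : ∀ x ∈ Z, x ∈ Flat := by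
    intro x hx
    rcases Relation.ReflTransGen.cases_tail hx with rfl | ⟨y, -, hy⟩
    · exact ⟨hc.symm, fun y hy => (hcon y hy).trans hc.symm⟩
    · exact hy.2
  have hsZ : s ∉ Z := fun h => hcs.ne' (hZ s h).1
  have htZ : t ∉ Z := fun h => hct.ne (hZ t h).1
  have hbdry : ∀ p q, p ∉ Z → q ∉ Z → p ≠ s → q ≠ s →
      ∃ k : G.Dart, k.fst ∉ Z ∧ k.snd ∈ Z ∧ k.fst ≠ p ∧ k.fst ≠ q := by
    intro p q hp hq hps hqs
    obtain ⟨x, hx, y, hy, hxy, hyp, hyq⟩ := h3.exists_adj_of_mem_of_notMem (p := p) (q := q) hvZ hsZ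
      (fun h => hp (h ▸ hvZ)) (fun h => hq (h ▸ hvZ)) hps.symm hqs.symm
    exact ⟨⟨(y, x), hxy.symm⟩, hy, hx, hyp, hyq⟩
  have hheight : ∀ k : G.Dart, k.snd ∈ Z → f k.fst = c := fun k hk => (hZ _ hk).2 _ k.adj.symm
  have hks : ∀ k : G.Dart, k.snd ∈ Z → k.fst ≠ s := fun k hk h =>
    hcs.ne' (h ▸ hheight k hk)
  have hkt : ∀ k : G.Dart, k.snd ∈ Z → k.fst ≠ t := fun k hk h =>
    hct.ne (h ▸ hheight k hk)
  have hts' : t ≠ s := fun h => hts.ne (congrArg f h)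
  obtain ⟨k₀, h0, h0', -⟩ := hbdry t t htZ htZ hts' hts'
  obtain ⟨k₁, h1, h1', h10, -⟩ := hbdry _ _ h0 h0 (hks _ h0') (hks _ h0')
  obtain ⟨k₂, h2, h2', h20, h21⟩ := hbdry _ _ h0 h1 (hks _ h0') (hks _ h1')
  let k : Fin 3 → G.Dart := ![k₀, k₁, k₂]
  have hkZ : ∀ i, (k i).fst ∉ Z ∧ (k i).snd ∈ Z := by
    intro i
    fin_cases i
    exacts [⟨h0, h0'⟩, ⟨h1, h1'⟩, ⟨h2, h2'⟩]
  have hkinj : Function.Injective fun i => (k i).fst := by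
    intro i j hij
    fin_cases i <;> fin_cases j <;> first | rfl | skip
    exacts [(h10 hij.symm).elim, (h20 hij.symm).elim, (h10 hij).elim, (h21 hij.symm).elim,
      (h20 hij).elim, (h21 hij).elim]
  have hvar : ∀ i, ∃ y, G.Adj (k i).fst y ∧ f y ≠ f (k i).fst := by
    intro i
    by_contra! h
    have hic := hheight _ (hkZ i).2
    exact (hkZ i).1 (Relation.ReflTransGen.tail (hkZ i).2
      ⟨(k i).adj.symm, hic, fun y hy => (h y hy).trans hic⟩)
  obtain ⟨i, j, φ, hne, hφ⟩ := R.exists_coloring_ne_of_three hG hE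
    (hf.preconnected_superlevel hG hct.le hcs) (hf.preconnected_sublevel hG hct hcs.le)
    (Set.disjoint_left.2 fun x (h : c < f x) (h' : f x < c) => lt_asymm h h') k hkinj
    (fun i (h : c < f _) => h.ne' (hheight _ (hkZ i).2))
    (fun i (h : f _ < c) => h.ne (hheight _ (hkZ i).2))
    (fun i => by
      obtain ⟨y, hy, hne⟩ := hvar i
      obtain ⟨z, hz, h⟩ := hf.exists_adj_gt (hks _ (hkZ i).2) (hkt _ (hkZ i).2) hy hne
      exact ⟨z, by rwa [hheight _ (hkZ i).2] at h, hz⟩)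
    (fun i => by
      obtain ⟨y, hy, hne⟩ := hvar i
      obtain ⟨z, hz, h⟩ := hf.exists_adj_lt (hks _ (hkZ i).2) (hkt _ (hkZ i).2) hy hne
      exact ⟨z, by rwa [hheight _ (hkZ i).2] at h, hz⟩)
  -- the separating cycle avoids `Z`, so the colour is constant around `Z`
  have hφZ : ∀ d : G.Dart, d.fst ∈ Z → φ (R.leftFace d) = φ (R.rightFace d) := fun d hd =>
    hφ d (fun h : c < f _ => h.ne' (hZ _ hd).1) (fun h : f _ < c => h.ne (hZ _ hd).1)
      fun i h => (hkZ i).1 (h ▸ hd)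
  obtain ⟨w, hvw, -⟩ := h3.exists_adj_ne hvs
  let e : G.Dart := ⟨(v, w), hvw⟩
  have hconst : ∀ x ∈ Z, ∀ d : G.Dart, d.fst = x → φ (R.leftFace d) = φ (R.leftFace e) := by
    intro x hx
    induction hx with
    | refl => exact fun d hd => R.label_eq_of_fst_eq (fun d' h => hφZ d' (h ▸ hvZ)) hd rfl
    | @tail b b' hb hbb' ih =>
      intro d hd
      have hb' : b' ∈ Z := Relation.ReflTransGen.tail hb hbb'
      let g : G.Dart := ⟨(b, b'), hbb'.1⟩
      rw [← ih g rfl, R.label_eq_of_fst_eq (fun d' h => hφZ d' (h ▸ hb')) hd (d' := g.symm) rfl]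
      exact (hφZ g hb).symm
  have hk : ∀ i, φ (R.leftFace (k i)) = φ (R.leftFace e) := by
    intro i
    rw [← hconst _ (hkZ i).2 (k i).symm rfl, hφZ (k i).symm (hkZ i).2, R.rightFace_symm]
  exact hne ((hk i).trans (hk j).symm)

end IsHarmonicOff

/-! ### The squaring -/

namespace RotationSystem

variable {V : Type*} {G : SimpleGraph V} (R : RotationSystem G)

theorem leftFace_faceNext (d : G.Dart) : R.leftFace (R.faceNext d) = R.leftFace d :=
  Quotient.sound (⟨-1, by simp⟩ : R.faceNext.SameCycle (R.faceNext d) d)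

theorem faceNext_fst (d : G.Dart) : (R.faceNext d).fst = d.snd := by
  have h := R.rot_fst (R.faceNext d)
  rw [← h]
  simp [faceNext, flip]

/-- A face does not turn back at a vertex of degree at least two. -/
theorem faceNext_ne_symm [Finite V] {d : G.Dart} {w : V} (hw : G.Adj d.snd w) (hne : w ≠ d.fst) :
    R.faceNext d ≠ d.symm := by
  intro h
  have hfix : R.rot d.symm = d.symm := by
    conv_lhs => rw [← h]
    simp [faceNext, flip]
  obtain ⟨n, hn⟩ := R.exists_rot_pow_eq (d := d.symm) (d' := ⟨(d.snd, w), hw⟩) rfl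
  rw [Equiv.Perm.pow_apply_eq_self_of_apply_eq_self hfix] at hn
  exact hne (congrArg (fun e : G.Dart => e.snd) hn).symm

end RotationSystem

namespace EdgeRootedPlanarMap

variable {V : Type*} [Fintype V] [DecidableEq V] {G : SimpleGraph V} [DecidableRel G.Adj]
  (M : EdgeRootedPlanarMap G)

theorem mem_arcs {d : G.Dart} : d ∈ M.arcs ↔ d ≠ M.root ∧ d ≠ M.root.symm := by
  simp [arcs]

theorem vertexPotential_root_fst : M.vertexPotential M.root.fst = 1 :=
  M.isPotential_vertexPotential.1

theorem vertexPotential_root_snd : M.vertexPotential M.root.snd = 0 :=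
  M.isPotential_vertexPotential.2.1

theorem vertexPotential_root_lt :
    M.vertexPotential M.root.snd < M.vertexPotential M.root.fst := by
  rw [vertexPotential_root_fst, vertexPotential_root_snd]
  exact one_pos

/-- At vertices other than `s` and `t`, cutting the root edge does not change Kirchhoff's law. -/
theorem isHarmonicOff_vertexPotential :
    IsHarmonicOff G M.root.fst M.root.snd M.vertexPotential := by
  intro x hs ht
  rw [← M.isPotential_vertexPotential.2.2 x hs ht]
  refine Finset.sum_congr (Finset.ext fun d => ?_) fun _ _ => rfl
  simp only [Finset.mem_filter, Finset.mem_univ, true_and, mem_arcs]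
  refine ⟨fun h => ⟨⟨?_, ?_⟩, h⟩, And.right⟩
  · rintro rfl
    exact hs h.symm
  · rintro rfl
    exact ht h.symm

/-- A current flows through some edge at each vertex. -/
theorem exists_arc_fst_eq (hG : IsThreeConnected G) (v : V) :
    ∃ d ∈ M.arcs, d.fst = v ∧ M.vertexPotential d.fst ≠ M.vertexPotential d.snd := by
  have hf := M.isHarmonicOff_vertexPotential
  by_cases hs : v = M.root.fst
  · obtain ⟨w, hw, hne⟩ := hG.exists_adj_ne (hs ▸ M.root.adj.ne : v ≠ M.root.snd)
    refine ⟨⟨(v, w), hw⟩, M.mem_arcs.2 ⟨?_, ?_⟩, rfl, ?_⟩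
    · exact fun h => hne (congrArg (fun d : G.Dart => d.snd) h)
    · exact fun h => M.root.adj.ne (hs.symm.trans (congrArg (fun d : G.Dart => d.fst) h))
    · subst hs
      exact (hf.lt_source M.connected hG M.vertexPotential_root_lt hw.ne').ne'
  by_cases ht : v = M.root.snd
  · obtain ⟨w, hw, hne⟩ := hG.exists_adj_ne hs
    refine ⟨⟨(v, w), hw⟩, M.mem_arcs.2 ⟨?_, ?_⟩, rfl, ?_⟩
    · exact fun h => hs (congrArg (fun d : G.Dart => d.fst) h)
    · exact fun h => hne (congrArg (fun d : G.Dart => d.snd) h)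
    · subst ht
      exact (hf.sink_lt M.connected hG M.vertexPotential_root_lt hw.ne').ne
  obtain ⟨w, hw, hne⟩ := hf.exists_adj_ne M.toRotationSystem M.connected M.euler hG
    M.vertexPotential_root_lt hs ht
  refine ⟨⟨(v, w), hw⟩, M.mem_arcs.2 ⟨?_, ?_⟩, rfl, hne.symm⟩
  · exact fun h => hs (congrArg (fun d : G.Dart => d.fst) h)
  · exact fun h => ht (congrArg (fun d : G.Dart => d.fst) h)

/-- A current flows through some edge on the boundary of each face. Otherwise the face would
contain three corners at vertices of one height, each with neighbours above and below, and a new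
vertex inside the face, joined to these three, would give a planar `K₃,₃` minor. -/
theorem exists_arc_leftFace_eq (hG : IsThreeConnected G) (f : M.Face) :
    ∃ d ∈ M.arcs, M.leftFace d = f ∧ M.vertexPotential d.fst ≠ M.vertexPotential d.snd := by
  have hf := M.isHarmonicOff_vertexPotential
  have hts := M.vertexPotential_root_lt
  by_contra! hcon
  have hturn : ∀ d : G.Dart, M.faceNext d ≠ d.symm := fun d =>
    let ⟨_, hw, hne⟩ := hG.exists_adj_ne d.adj.ne'
    M.faceNext_ne_symm hw hne
  -- the arc after the root edge would be a currentless arc at `s` or `t`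
  have hnext : ∀ d : G.Dart, d = M.root ∨ d = M.root.symm → M.leftFace d ≠ f := by
    intro d hd hdf
    have hfst := M.faceNext_fst d
    have harc : M.faceNext d ∈ M.arcs := by
      have hself : M.faceNext d ≠ d := fun h => d.adj.ne (by rwa [h] at hfst)
      have := hturn d
      rcases hd with rfl | rfl
      · exact M.mem_arcs.2 ⟨hself, this⟩
      · exact M.mem_arcs.2 ⟨by simpa using this, hself⟩
    have h := hf.ne_of_adj_of_eq M.connected hG hts (M.faceNext d).adj
      (hcon _ harc ((M.leftFace_faceNext d).trans hdf))
    rw [hfst] at h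
    rcases hd with rfl | rfl
    · exact h.2 rfl
    · exact h.1 rfl
  have hflat : ∀ d, M.leftFace d = f → M.vertexPotential d.fst = M.vertexPotential d.snd :=
    fun d hd => hcon d (M.mem_arcs.2 ⟨fun h => hnext d (Or.inl h) hd,
      fun h => hnext d (Or.inr h) hd⟩) hd
  obtain ⟨d₀, hd₀⟩ : ∃ d, M.leftFace d = f := Quotient.exists_rep f
  obtain ⟨d₁, hd₁⟩ : ∃ d, d = M.faceNext d₀ := ⟨_, rfl⟩
  obtain ⟨d₂, hd₂⟩ : ∃ d, d = M.faceNext d₁ := ⟨_, rfl⟩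
  have h01 : d₁.fst = d₀.snd := hd₁ ▸ M.faceNext_fst d₀
  have h12 : d₂.fst = d₁.snd := hd₂ ▸ M.faceNext_fst d₁
  have hface₁ : M.leftFace d₁ = f := by rw [hd₁, M.leftFace_faceNext, hd₀]
  have hface₂ : M.leftFace d₂ = f := by rw [hd₂, M.leftFace_faceNext, hface₁]
  have hne01 : d₀.fst ≠ d₁.fst := h01 ▸ d₀.adj.ne
  have hne12 : d₁.fst ≠ d₂.fst := h12 ▸ d₁.adj.ne
  have hne02 : d₀.fst ≠ d₂.fst := by
    intro h
    refine hturn d₀ ?_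
    rw [← hd₁]
    exact SimpleGraph.Dart.ext _ _ (Prod.ext h01 (h12.symm.trans h.symm))
  obtain ⟨c, hc⟩ : ∃ c, M.vertexPotential d₀.fst = c := ⟨_, rfl⟩
  have hc₁ : M.vertexPotential d₁.fst = c := by rw [h01, ← hflat d₀ hd₀, hc]
  have hc₂ : M.vertexPotential d₂.fst = c := by rw [h12, ← hflat d₁ hface₁, hc₁]
  let k : Fin 3 → G.Dart := ![d₀, d₁, d₂]
  have hkf : ∀ i, M.leftFace (k i) = f := by
    intro i
    fin_cases i
    exacts [hd₀, hface₁, hface₂]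
  have hkc : ∀ i, M.vertexPotential (k i).fst = c := by
    intro i
    fin_cases i
    exacts [hc, hc₁, hc₂]
  have hkinj : Function.Injective fun i => (k i).fst := by
    intro i j hij
    fin_cases i <;> fin_cases j <;> first | rfl | skip
    exacts [(hne01 hij).elim, (hne02 hij).elim, (hne01 hij.symm).elim, (hne12 hij).elim,
      (hne02 hij.symm).elim, (hne12 hij.symm).elim]
  have hkst : ∀ i, (k i).fst ≠ M.root.fst ∧ (k i).fst ≠ M.root.snd := fun i =>
    hf.ne_of_adj_of_eq M.connected hG hts (k i).adj (hflat _ (hkf i))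
  have hvar := fun i => hf.exists_adj_ne M.toRotationSystem M.connected M.euler hG hts
    (hkst i).1 (hkst i).2
  have hcs : c < M.vertexPotential M.root.fst :=
    hkc 0 ▸ hf.lt_source M.connected hG hts (hkst 0).1
  have hct : M.vertexPotential M.root.snd < c :=
    hkc 0 ▸ hf.sink_lt M.connected hG hts (hkst 0).2
  obtain ⟨i, j, φ, hne, -⟩ := M.exists_coloring_ne_of_three M.connected M.euler
    (hf.preconnected_superlevel M.connected hct.le hcs)
    (hf.preconnected_sublevel M.connected hct hcs.le)
    (Set.disjoint_left.2 fun x (h : c < _) (h' : _ < c) => lt_asymm h h') k hkinj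
    (fun i (h : c < _) => h.ne' (hkc i)) (fun i (h : _ < c) => h.ne (hkc i))
    (fun i => by
      obtain ⟨y, hy, hne⟩ := hvar i
      obtain ⟨z, hz, h⟩ := hf.exists_adj_gt (hkst i).1 (hkst i).2 hy hne
      exact ⟨z, by rwa [hkc i] at h, hz⟩)
    (fun i => by
      obtain ⟨y, hy, hne⟩ := hvar i
      obtain ⟨z, hz, h⟩ := hf.exists_adj_lt (hkst i).1 (hkst i).2 hy hne
      exact ⟨z, by rwa [hkc i] at h, hz⟩)
  exact hne (by rw [hkf i, hkf j])

theorem side_pos {d : G.Dart} (h : M.vertexPotential d.fst ≠ M.vertexPotential d.snd) :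
    0 < M.side d := abs_pos.2 (sub_ne_zero.2 h)

theorem isCompact_square (d : G.Dart) : IsCompact (M.square d) := isCompact_Icc.prod isCompact_Icc

theorem isCompact_vertexSquares (v : V) : IsCompact (M.vertexSquares v) :=
  (Set.toFinite _).isCompact_biUnion fun d _ => M.isCompact_square d

theorem isCompact_faceSquares (f : M.Face) : IsCompact (M.faceSquares f) := by
  classical
  exact (Set.toFinite _).isCompact_biUnion fun d _ => M.isCompact_square d

end EdgeRootedPlanarMap

theorem IsCompact.csInf_lt_csSup {S : Set ℝ} (hS : IsCompact S) {a b : ℝ} (ha : a ∈ S)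
    (hb : b ∈ S) (hab : a < b) : sInf S < sSup S :=
  (csInf_le hS.bddBelow ha).trans_lt (hab.trans_le (le_csSup hS.bddAbove hb))

theorem mainTheorem10 {V : Type*} [Fintype V] [DecidableEq V] (G : SimpleGraph V)
    [DecidableRel G.Adj] (M : EdgeRootedPlanarMap G) (hG : IsThreeConnected G) :
    (∀ v : V, (M.primalLine v).Nontrivial) ∧ (∀ f : M.Face, (M.facialLine f).Nontrivial) := by
  constructor
  · intro v
    obtain ⟨d, hd, hdv, hne⟩ := M.exists_arc_fst_eq hG v
    have hpos := M.side_pos hne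
    have hsub : M.square d ⊆ M.vertexSquares v :=
      Set.subset_biUnion_of_mem (u := M.square) (Finset.mem_filter.2 ⟨hd, hdv⟩)
    have hlt := ((M.isCompact_vertexSquares v).image continuous_fst).csInf_lt_csSup
      (a := M.left d) (b := M.left d + M.side d)
      ⟨(M.left d, M.top d), hsub ⟨⟨le_rfl, by linarith⟩, ⟨by linarith, le_rfl⟩⟩, rfl⟩
      ⟨(M.left d + M.side d, M.top d), hsub ⟨⟨by linarith, le_rfl⟩, ⟨by linarith, le_rfl⟩⟩, rfl⟩
      (by linarith)
    exact ⟨(_, _), ⟨Set.left_mem_Icc.2 hlt.le, rfl⟩, (_, _), ⟨Set.right_mem_Icc.2 hlt.le, rfl⟩,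
      fun h => hlt.ne (congrArg Prod.fst h)⟩
  · classical
    intro f
    obtain ⟨d, hd, hdf, hne⟩ := M.exists_arc_leftFace_eq hG f
    have hpos := M.side_pos hne
    have hsub : M.square d ⊆ M.faceSquares f :=
      Set.subset_biUnion_of_mem (u := M.square) (Finset.mem_filter.2 ⟨hd, hdf⟩)
    have hlt := ((M.isCompact_faceSquares f).image continuous_snd).csInf_lt_csSup
      (a := M.top d - M.side d) (b := M.top d)
      ⟨(M.left d, M.top d - M.side d), hsub ⟨⟨le_rfl, by linarith⟩, ⟨le_rfl, by linarith⟩⟩, rfl⟩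
      ⟨(M.left d, M.top d), hsub ⟨⟨le_rfl, by linarith⟩, ⟨by linarith, le_rfl⟩⟩, rfl⟩
      (by linarith)
    exact ⟨(_, _), ⟨rfl, Set.left_mem_Icc.2 hlt.le⟩, (_, _), ⟨rfl, Set.right_mem_Icc.2 hlt.le⟩,
      fun h => hlt.ne (congrArg Prod.snd h)⟩
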